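/- Let $E$ be a Hausdorff locally convex space over $\mathbb{K}\in\{\mathbb{R},\mathbb{C}\}$. Assume that $E$ is $\kappa$-Fréchet–Urysohn, i.e. for every open set $U\subseteq E$ and every $x\in\overline{U}$ there is a sequence of points of $U$ converging to $x$. Let $\widehat{E}$ denote the completion of $E$, and regard $E$ as a subspace of $\widehat{E}$. Call a subset of $E$ absolutely convex if it is convex and balanced. Then the following assertions are equivalent: (i) $E$ is Baire-like: for every increasing sequence $A_0\subseteq A_1\subseteq\cdots$ of closed absolutely convex subsets of $E$ with $\bigcup_{n} A_n=E$, there is an $n$ such that $A_n$ is a neighborhood of zero in $E$; (ii) $E$ is barrelled: every lower semicontinuous seminorm on $E$ is continuous (equivalently, every closed absolutely convex absorbing subset of $E$ is a neighborhood of zero); (iii) for every increasing sequence $A_0\subseteq A_1\subseteq\cdots$ of closed absolutely convex subsets of $E$ with $\bigcup_{n} A_n=E$, one has $\widehat{E}=\bigcup_{n}\overline{A_n}$, where $\overline{A_n}$ is the closure of $A_n$ in $\widehat{E}$. -/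

import Mathlib

open Filter Topology Set

/-- `X` is `κ`-Fréchet–Urysohn: every point of the closure of an open set `U` is the limit of a
sequence of points of `U`. -/
def IsKappaFrechetUrysohn (X : Type*) [TopologicalSpace X] : Prop :=
  ∀ U : Set X, IsOpen U → ∀ x ∈ closure U,
    ∃ u : ℕ → X, (∀ n, u n ∈ U) ∧ Tendsto u atTop (𝓝 x)

/-- `A` is an increasing sequence of closed absolutely convex (that is, convex and balanced over
the scalar field `𝕜`) subsets of `E` covering `E`. -/
structure IsAbsConvexCover (𝕜 : Type*) [RCLike 𝕜] {E : Type*} [AddCommGroup E] [Module 𝕜 E]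
    [Module ℝ E] [TopologicalSpace E] (A : ℕ → Set E) : Prop where
  monotone : Monotone A
  isClosed : ∀ n, IsClosed (A n)
  balanced : ∀ n, Balanced 𝕜 (A n)
  convex : ∀ n, Convex ℝ (A n)
  iUnion_eq : ⋃ n, A n = univ

/-- `E` is Baire-like: in every increasing sequence of closed absolutely convex sets covering `E`,
some member is a neighbourhood of zero. -/
def IsBaireLike (𝕜 : Type*) [RCLike 𝕜] (E : Type*) [AddCommGroup E] [Module 𝕜 E]
    [Module ℝ E] [TopologicalSpace E] : Prop :=
  ∀ A : ℕ → Set E, IsAbsConvexCover 𝕜 A → ∃ n, A n ∈ 𝓝 (0 : E)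

/-! If no `A n` is a neighbourhood of zero, then zero is adherent to every open complement, and the
κ-Fréchet–Urysohn property yields a single null sequence with `z k ∉ A (n k)` and `n k → ∞`. Under
barrelledness, Hahn–Banach gives functionals bounded by 1 on `A (n k)` and larger than 1 at `z k`;
they are pointwise bounded because the sets cover, so Banach–Steinhaus contradicts `z k → 0`. Under
(iii), the same construction is run on the sets `(n + 1) A n`. A null sequence is the image of a
bounded sequence of a normed space, and Baire's theorem in the completion of that space puts the
whole sequence in a multiple of one `A m`, a contradiction. -/

namespace IsKappaFrechetUrysohn

/-- In a `κ`-Fréchet–Urysohn topological group in which `0` is the limit of a sequence of nonzero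
points, one can choose a null sequence diagonally from a sequence of open sets adherent to `0`. -/
theorem exists_diagonal_seq {E : Type*} [AddCommGroup E] [TopologicalSpace E]
    [IsTopologicalAddGroup E] [T2Space E] (hE : IsKappaFrechetUrysohn E) {y : ℕ → E}
    (hy : Tendsto y atTop (𝓝 0)) (hy0 : ∀ n, y n ≠ 0) {F : ℕ → Set E} (hF : ∀ n, IsOpen (F n))
    (h0 : ∀ n, (0 : E) ∈ closure (F n)) :
    ∃ (z : ℕ → E) (n : ℕ → ℕ), Tendsto z atTop (𝓝 0) ∧ Tendsto n atTop atTop ∧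
      ∀ k, z k ∈ F (n k) := by
  choose P Q hP hQ hyP hQ0 hPQ using fun n => t2_separation (hy0 n)
  -- `F n` translated by `y n`, and cut by `P n` below to stay away from zero.
  set S : ℕ → Set E := fun n => (Homeomorph.subRight (y n)) ⁻¹' F n with hS
  have hSo : ∀ n, IsOpen (S n) := fun n => (hF n).preimage (Homeomorph.subRight (y n)).continuous
  have hyS : ∀ n, y n ∈ closure (S n) := fun n => by
    rw [hS, ← Homeomorph.preimage_closure]
    simpa using h0 n
  have hcl : (0 : E) ∈ closure (⋃ n, P n ∩ S n) := by
    refine isClosed_closure.mem_of_tendsto hy (Eventually.of_forall fun n => ?_)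
    exact closure_mono (subset_iUnion (fun n => P n ∩ S n) n)
      ((hP n).inter_closure ⟨hyP n, hyS n⟩)
  obtain ⟨u, huU, hu⟩ := hE _ (isOpen_iUnion fun n => (hP n).inter (hSo n)) 0 hcl
  simp only [mem_iUnion] at huU
  choose n hnP hnS using huU
  -- No index recurs infinitely often: `u` eventually enters `Q i`, which misses `P i`.
  have hn : Tendsto n atTop atTop := by
    refine tendsto_atTop.2 fun N => ?_
    have : ∀ᶠ k in atTop, ∀ i ∈ Finset.range N, u k ∈ Q i :=
      (Filter.eventually_all_finset _).2 fun i _ => hu ((hQ i).mem_nhds (hQ0 i))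
    filter_upwards [this] with k hk
    by_contra! hlt
    exact (hPQ (n k)).ne_of_mem (hnP k) (hk (n k) (Finset.mem_range.2 hlt)) rfl
  refine ⟨fun k => u k - y (n k), n, ?_, hn, fun k => hnS k⟩
  simpa using hu.sub (hy.comp hn)

end IsKappaFrechetUrysohn

/-! ### Null sequences and the ℓ¹ norm -/

/-- Every null sequence in a locally convex space is the image of a sequence in the unit ball of a
seminormed space under a continuous linear map. -/
theorem exists_continuousLinearMap_of_tendsto_zero {E : Type*} [AddCommGroup E] [Module ℝ E]
    [TopologicalSpace E] [IsTopologicalAddGroup E] [ContinuousSMul ℝ E] [LocallyConvexSpace ℝ E]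
    {z : ℕ → E} (hz : Tendsto z atTop (𝓝 0)) :
    ∃ (X : Type) (_ : SeminormedAddCommGroup X) (_ : NormedSpace ℝ X) (T : X →L[ℝ] E) (e : ℕ → X),
      (∀ k, ‖e k‖ ≤ 1) ∧ ∀ k, T (e k) = z k := by
  let N : AddGroupSeminorm (ℕ →₀ ℝ) :=
    { toFun := fun a => a.sum fun _ r => |r|
      map_zero' := by simp
      add_le' := fun a b => by
        classical
        have h : ∀ c : ℕ →₀ ℝ, c.support ⊆ a.support ∪ b.support →
            (c.sum fun _ r => |r|) = ∑ i ∈ a.support ∪ b.support, |c i| := fun c hc =>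
          Finsupp.sum_of_support_subset c hc _ (by simp)
        rw [h _ Finsupp.support_add, h a Finset.subset_union_left, h b Finset.subset_union_right,
          ← Finset.sum_add_distrib]
        exact Finset.sum_le_sum fun i _ => abs_add_le _ _
      neg' := fun a => by simp [Finsupp.sum] }
  let _ : SeminormedAddCommGroup (ℕ →₀ ℝ) := N.toSeminormedAddCommGroup
  have hnorm : ∀ a : ℕ →₀ ℝ, ‖a‖ = a.sum fun _ r => |r| := fun _ => rfl
  let _ : NormedSpace ℝ (ℕ →₀ ℝ) :=
    { norm_smul_le := fun c a => by
        rw [hnorm, hnorm, Finsupp.sum_smul_index' (by simp)]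
        simp [Finsupp.sum, Finset.mul_sum, abs_mul] }
  let T : (ℕ →₀ ℝ) →ₗ[ℝ] E := Finsupp.linearCombination ℝ z
  -- Each continuous seminorm is bounded along `z`, and that bound controls it against the ℓ¹ norm.
  have hT : Continuous T := by
    refine WithSeminorms.continuous_normedSpace_dom _ (with_gaugeSeminormFamily (𝕜 := ℝ) (E := E)) T fun i => ?_
    set p := gaugeSeminormFamily ℝ E i
    have hp : Continuous p := (with_gaugeSeminormFamily (𝕜 := ℝ) (E := E)).continuous_seminorm i
    obtain ⟨C, hC⟩ := ((hp.tendsto 0).comp hz).bddAbove_range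
    have hC' : ∀ k, p (z k) ≤ C := fun k => hC ⟨k, rfl⟩
    refine ⟨⟨C, (apply_nonneg p _).trans (hC' 0)⟩, fun a => ?_⟩
    change p (Finsupp.linearCombination ℝ z a) ≤ C * ‖a‖
    rw [hnorm, Finsupp.linearCombination_apply, Finsupp.sum, Finsupp.sum, Finset.mul_sum]
    refine (Finset.le_sum_of_subadditive p (map_zero p).le (map_add_le_add p) _ _).trans (Finset.sum_le_sum fun k _ => ?_)
    rw [map_smul_eq_mul, Real.norm_eq_abs, mul_comm]
    exact mul_le_mul_of_nonneg_right (hC' k) (abs_nonneg _)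
  refine ⟨ℕ →₀ ℝ, inferInstance, inferInstance, ⟨T, hT⟩, fun k => Finsupp.single k 1,
    fun k => ?_, fun k => ?_⟩
  · rw [hnorm, Finsupp.sum_single_index] <;> simp
  · change Finsupp.linearCombination ℝ z (Finsupp.single k 1) = z k
    simp

theorem mem_nhds_zero_of_smul_preimage {E : Type*} [AddCommGroup E] [Module ℝ E]
    [TopologicalSpace E] [ContinuousConstSMul ℝ E] {s : Set E} {c : ℝ} (hc : c ≠ 0)
    (h : (fun x : E => c • x) ⁻¹' s ∈ 𝓝 (0 : E)) : s ∈ 𝓝 (0 : E) := by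
  have : (fun x : E => c⁻¹ • x) ⁻¹' ((fun x : E => c • x) ⁻¹' s) ∈ 𝓝 (0 : E) :=
    (continuous_const_smul c⁻¹).tendsto' (0 : E) 0 (smul_zero _) h
  simpa only [preimage_preimage, smul_smul, mul_inv_cancel₀ hc, one_smul, preimage_id'] using this

/-! ### Covers and their rescalings -/

namespace IsAbsConvexCover

variable {𝕜 : Type*} [RCLike 𝕜] {E : Type*} [AddCommGroup E] [Module 𝕜 E]
  [Module ℝ E] [TopologicalSpace E] {A : ℕ → Set E}

theorem exists_mem (hA : IsAbsConvexCover 𝕜 A) (x : E) : ∃ n, x ∈ A n := by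
  simpa using hA.iUnion_eq.ge (mem_univ x)

theorem add_mem_of_two_smul_mem (hA : IsAbsConvexCover 𝕜 A) {n : ℕ} {x y : E} (hx : (2 : ℝ) • x ∈ A n)
    (hy : (2 : ℝ) • y ∈ A n) : x + y ∈ A n := by
  have := hA.convex n hx hy (a := 1 / 2) (b := 1 / 2) (by norm_num) (by norm_num) (by norm_num)
  simpa [smul_smul] using this

theorem exists_diagonal_seq [IsTopologicalAddGroup E] [ContinuousSMul ℝ E] [T2Space E]
    (hE : IsKappaFrechetUrysohn E) (hA : IsAbsConvexCover 𝕜 A) (h : ∀ n, A n ∉ 𝓝 (0 : E)) :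
    ∃ (z : ℕ → E) (n : ℕ → ℕ), Tendsto z atTop (𝓝 0) ∧ Tendsto n atTop atTop ∧
      ∀ k, z k ∉ A (n k) := by
  cases subsingleton_or_nontrivial E with
  | inl _ =>
    obtain ⟨n, hn⟩ := hA.exists_mem 0
    exact absurd (by rw [Subsingleton.eq_univ_of_nonempty ⟨0, hn⟩]; exact univ_mem) (h n)
  | inr _ =>
    obtain ⟨v, hv⟩ := exists_ne (0 : E)
    refine hE.exists_diagonal_seq (y := fun n => (1 / ((n : ℝ) + 1)) • v) ?_ (fun n => ?_)
      (fun n => (hA.isClosed n).isOpen_compl) (fun n => ?_)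
    · simpa using (tendsto_one_div_add_atTop_nhds_zero_nat (𝕜 := ℝ)).smul_const v
    · exact smul_ne_zero (by positivity) hv
    · rw [closure_compl, mem_compl_iff, mem_interior_iff_mem_nhds]
      exact h n

variable [IsScalarTower ℝ 𝕜 E]

theorem real_smul_mem (hA : IsAbsConvexCover 𝕜 A) {n : ℕ} {x : E} (hx : x ∈ A n) {c : ℝ}
    (hc : |c| ≤ 1) : c • x ∈ A n := by
  rw [← algebraMap_smul 𝕜 c x]
  exact (hA.balanced n).smul_mem (by simpa using hc) hx

/-- Used with `c n = 2` to halve the sets and with `c n = 1 / (n + 1)` to enlarge them without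
bound. -/
theorem smul_preimage [ContinuousConstSMul ℝ E] (hA : IsAbsConvexCover 𝕜 A) {c : ℕ → ℝ}
    (hc : ∀ n, 0 < c n) (hc' : Antitone c) :
    IsAbsConvexCover 𝕜 fun n => (fun x : E => c n • x) ⁻¹' A n := by
  have key : ∀ {i j k} {x : E}, i ≤ j → c i • x ∈ A k → c j • x ∈ A k := fun {i j k x} hij hx => by
    have := hA.real_smul_mem hx (c := c j / c i) (by
      rw [abs_of_pos (div_pos (hc j) (hc i))]
      exact (div_le_one (hc i)).2 (hc' hij))
    rwa [smul_smul, div_mul_cancel₀ _ (hc i).ne'] at this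
  refine ⟨fun m n hmn x hx => hA.monotone hmn (key hmn hx),
    fun n => (hA.isClosed n).preimage (continuous_const_smul _), fun n => ?_, fun n => ?_, ?_⟩
  · refine balanced_iff_smul_mem.2 fun a ha x hx => ?_
    have : c n • a • x = a • c n • x := by
      rw [← algebraMap_smul 𝕜 (c n) (a • x), ← algebraMap_smul 𝕜 (c n) x, smul_comm]
    simpa only [mem_preimage, this] using (hA.balanced n).smul_mem ha hx
  · exact (hA.convex n).is_linear_preimage ⟨smul_add _, smul_comm _⟩
  · refine eq_univ_of_forall fun x => ?_
    obtain ⟨m, hm⟩ := hA.exists_mem (c 0 • x)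
    exact mem_iUnion.2 ⟨m, key (Nat.zero_le m) hm⟩

end IsAbsConvexCover

/-- A point outside a closed absolutely convex set is separated from it by a continuous linear
functional which is bounded by `1` on the set. -/
theorem Balanced.exists_strongDual_norm_le_one {𝕜 : Type*} [RCLike 𝕜] {E : Type*} [AddCommGroup E]
    [Module 𝕜 E] [Module ℝ E] [IsScalarTower ℝ 𝕜 E] [TopologicalSpace E] [IsTopologicalAddGroup E]
    [ContinuousSMul 𝕜 E] [LocallyConvexSpace ℝ E] {s : Set E} (hb : Balanced 𝕜 s)
    (hc : Convex ℝ s) (hs : IsClosed s) (h0 : (0 : E) ∈ s) {z : E} (hz : z ∉ s) :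
    ∃ f : StrongDual 𝕜 E, (∀ a ∈ s, ‖f a‖ ≤ 1) ∧ 1 < ‖f z‖ := by
  obtain ⟨f, u, hf, hfz⟩ := RCLike.geometric_hahn_banach_closed_point (𝕜 := 𝕜) hc hs hz
  have hu : 0 < u := by simpa using hf 0 h0
  have hle : ∀ a ∈ s, ‖f a‖ ≤ u := fun a ha => by
    -- Rotating `a` by a unit scalar turns the bound on the real part into one on the norm.
    obtain ⟨c, hc1, hca⟩ := RCLike.exists_norm_eq_mul_self (f a)
    have := hf (c • a) (hb.smul_mem hc1.le ha)
    rw [map_smul, smul_eq_mul, ← hca, RCLike.ofReal_re] at this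
    exact this.le
  have hn : ∀ x, ‖(((u⁻¹ : ℝ) : 𝕜) • f) x‖ = u⁻¹ * ‖f x‖ := fun x => by
    simp [abs_of_pos hu]
  refine ⟨((u⁻¹ : ℝ) : 𝕜) • f, fun a ha => ?_, ?_⟩
  · rw [hn]
    exact (inv_mul_le_one₀ hu).2 (hle a ha)
  · rw [hn, one_lt_inv_mul₀ hu]
    exact hfz.trans_le (RCLike.re_le_norm _)

namespace UniformSpace.Completion

theorem add_mem_closure_image_coe {E : Type*} [AddCommGroup E] [UniformSpace E]
    [IsUniformAddGroup E] {s t : Set E} (h : ∀ a ∈ s, ∀ b ∈ s, a + b ∈ t) {x y : Completion E}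
    (hx : x ∈ closure ((fun a : E => (a : Completion E)) '' s))
    (hy : y ∈ closure ((fun a : E => (a : Completion E)) '' s)) :
    x + y ∈ closure ((fun a : E => (a : Completion E)) '' t) := by
  refine map_mem_closure₂ continuous_add hx hy ?_
  rintro _ ⟨a, ha, rfl⟩ _ ⟨b, hb, rfl⟩
  exact ⟨a + b, h a ha b hb, coe_add a b⟩

end UniformSpace.Completion

/-! ### The implications -/

section

variable {𝕜 : Type*} [RCLike 𝕜] {E : Type*} [AddCommGroup E] [Module 𝕜 E]
  [Module ℝ E] [IsScalarTower ℝ 𝕜 E] [UniformSpace E] [IsUniformAddGroup E]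
  [ContinuousSMul 𝕜 E]

theorem IsBaireLike.barrelledSpace (h : IsBaireLike 𝕜 E) : BarrelledSpace 𝕜 E := by
  refine ⟨fun p hp => ?_⟩
  obtain ⟨n, hn⟩ := h (fun n => p.closedBall 0 n)
    ⟨fun m n hmn => p.closedBall_mono (by exact_mod_cast hmn), fun n => by
      simpa [p.closedBall_zero_eq] using! hp.isClosed_preimage n,
      fun n => p.balanced_closedBall_zero n, fun n => p.convex_closedBall 0 n,
      eq_univ_of_forall fun x => mem_iUnion.2 (exists_nat_ge (p (x - 0)))⟩
  exact Seminorm.continuous' hn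

theorem IsKappaFrechetUrysohn.isBaireLike_of_barrelledSpace [LocallyConvexSpace ℝ E] [T2Space E]
    (hE : IsKappaFrechetUrysohn E) [BarrelledSpace 𝕜 E] : IsBaireLike 𝕜 E := by
  have : ContinuousSMul ℝ E := IsScalarTower.continuousSMul 𝕜
  intro A hA
  by_contra! h
  obtain ⟨z, n, hz, hn, hzn⟩ := hA.exists_diagonal_seq hE h
  -- Early sets may be empty; shifting by `K` ensures that zero lies in each set being separated.
  obtain ⟨m, hm⟩ := hA.exists_mem 0
  obtain ⟨K, hK⟩ := eventually_atTop.1 (hn.eventually_ge_atTop m)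
  choose f hf hfz using fun k => (hA.balanced (n (k + K))).exists_strongDual_norm_le_one
    (hA.convex _) (hA.isClosed _) (hA.monotone (hK (k + K) (Nat.le_add_left _ _)) hm)
    (hzn (k + K))
  have heq : UniformEquicontinuous ((↑) ∘ f : ℕ → E → 𝕜) := by
    refine (norm_withSeminorms 𝕜 𝕜).banach_steinhaus fun _ x => ?_
    obtain ⟨l, hl⟩ := hA.exists_mem x
    refine IsBoundedUnder.bddAbove_range ⟨1, eventually_map.2 ?_⟩
    filter_upwards [(hn.comp (tendsto_add_atTop_nat K)).eventually_ge_atTop l] with k hk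
    exact hf k x (hA.monotone hk hl)
  have hz' := hz.comp (tendsto_add_atTop_nat K)
  obtain ⟨k, hk⟩ := (hz'.eventually
    (Metric.equicontinuousAt_iff_right.1 (heq.equicontinuous 0) 1 one_pos)).exists
  have := hk k
  simp only [Function.comp_apply, map_zero, dist_zero_left] at this
  exact lt_asymm this (hfz k)

theorem IsBaireLike.iUnion_closure_completion (h : IsBaireLike 𝕜 E) {A : ℕ → Set E}
    (hA : IsAbsConvexCover 𝕜 A) :
    ⋃ n, closure ((fun x : E => (x : UniformSpace.Completion E)) '' A n) = univ := by
  have : ContinuousSMul ℝ E := IsScalarTower.continuousSMul 𝕜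
  -- Halved sets, since `x` will be split as `(x - e) + e` with `e` in `E`.
  have hB := hA.smul_preimage (c := fun _ => 2) (fun _ => two_pos) antitone_const
  obtain ⟨n, hn⟩ := h _ hB
  refine eq_univ_of_forall fun x => ?_
  have h0 := UniformSpace.Completion.isDenseInducing_coe.closure_image_mem_nhds hn
  rw [UniformSpace.Completion.coe_zero] at h0
  have hx := (continuous_sub_left x).tendsto' x 0 (sub_self x) h0
  obtain ⟨_, ⟨e, rfl⟩, hu⟩ :=
    UniformSpace.Completion.isDenseInducing_coe.dense.inter_nhds_nonempty hx
  obtain ⟨m, hm⟩ := hB.exists_mem e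
  refine mem_iUnion.2 ⟨max n m, ?_⟩
  rw [← sub_add_cancel x (e : UniformSpace.Completion E)]
  exact UniformSpace.Completion.add_mem_closure_image_coe
    (fun a ha b hb => hA.add_mem_of_two_smul_mem ha hb)
    (closure_mono (image_mono (hB.monotone (le_max_left n m))) hu)
    (subset_closure ⟨e, hB.monotone (le_max_right n m) hm, rfl⟩)

/-- If the closures in the completion of a cover of `E` still cover, then some multiple of a member
of the cover contains any given null sequence. -/
theorem IsAbsConvexCover.exists_smul_mem_of_iUnion_closure_completion [LocallyConvexSpace ℝ E]
    {A : ℕ → Set E} (hA : IsAbsConvexCover 𝕜 A)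
    (h : ⋃ n, closure ((fun x : E => (x : UniformSpace.Completion E)) '' A n) = univ)
    {z : ℕ → E} (hz : Tendsto z atTop (𝓝 0)) :
    ∃ m, ∃ c : ℝ, 0 < c ∧ ∀ k, c • z k ∈ A m := by
  have : ContinuousSMul ℝ E := IsScalarTower.continuousSMul 𝕜
  obtain ⟨X, _, _, T, e, he, hTe⟩ := exists_continuousLinearMap_of_tendsto_zero hz
  let T' := (T : X →+ E).completion T.continuous
  have hT' : Continuous T' := AddMonoidHom.continuous_completion _ T.continuous
  have hT'e : ∀ x : X, T' x = (T x : E) := AddMonoidHom.completion_coe _ T.continuous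
  set D : ℕ → Set (UniformSpace.Completion E) := fun n =>
    closure ((fun x : E => (x : UniformSpace.Completion E)) '' A n) with hD
  obtain ⟨m, x, hx⟩ := nonempty_interior_of_iUnion_of_closed
    (f := fun n => T' ⁻¹' D n) (fun n => isClosed_closure.preimage hT')
    (by rw [← preimage_iUnion, h, preimage_univ])
  obtain ⟨r, hr, hball⟩ := Metric.mem_nhds_iff.1 (mem_interior_iff_mem_nhds.1 hx)
  have hneg : ∀ w ∈ D m, -w ∈ D m := fun w hw => by
    refine map_mem_closure continuous_neg hw ?_
    rintro _ ⟨a, ha, rfl⟩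
    exact ⟨-a, (hA.balanced m).neg_mem_iff.2 ha, UniformSpace.Completion.coe_neg a⟩
  -- `t` is `2 A m`: it absorbs the difference of two points of `D m`, which recovers the image of a
  -- small vector.
  set t : Set E := (fun w : E => (1 / 2 : ℝ) • w) ⁻¹' A m with ht
  have htc : IsClosed t := (hA.isClosed m).preimage (continuous_const_smul _)
  refine ⟨m, 1 / 2 * (r / 2), by positivity, fun k => ?_⟩
  have hxv : x + ((r / 2) • e k : X) ∈ T' ⁻¹' D m := hball (by
    rw [Metric.mem_ball, dist_self_add_left, UniformSpace.Completion.norm_coe, norm_smul,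
      Real.norm_of_nonneg (by positivity)]
    nlinarith [he k])
  have hsum := UniformSpace.Completion.add_mem_closure_image_coe (t := t)
    (fun a ha b hb => by
      rw [ht, mem_preimage, smul_add]
      exact hA.add_mem_of_two_smul_mem (by simpa [smul_smul] using ha)
        (by simpa [smul_smul] using hb)) hxv (hneg (T' x) (interior_subset hx :))
  rw [map_add, add_neg_cancel_comm, hT'e, map_smul, hTe] at hsum
  have hmem : (r / 2) • z k ∈ closure t := by
    rwa [UniformSpace.Completion.isDenseInducing_coe.isInducing.closure_eq_preimage_closure_image]
  rw [htc.closure_eq] at hmem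
  simpa only [ht, mem_preimage, smul_smul] using hmem

theorem IsKappaFrechetUrysohn.isBaireLike_of_iUnion_closure_completion [LocallyConvexSpace ℝ E]
    [T2Space E] (hE : IsKappaFrechetUrysohn E)
    (h : ∀ A : ℕ → Set E, IsAbsConvexCover 𝕜 A →
      ⋃ n, closure ((fun x : E => (x : UniformSpace.Completion E)) '' A n) = univ) :
    IsBaireLike 𝕜 E := by
  have : ContinuousSMul ℝ E := IsScalarTower.continuousSMul 𝕜
  intro A hA
  by_contra! hnot
  -- The factors `n + 1` outgrow any fixed multiple `1 / c` of `A m`.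
  have hB := hA.smul_preimage (c := fun n => 1 / ((n : ℝ) + 1)) (fun n => by positivity)
    fun m n hmn => one_div_le_one_div_of_le (by positivity) (by gcongr)
  obtain ⟨z, n, hz, hn, hzn⟩ := hB.exists_diagonal_seq hE fun n hn =>
    hnot n (mem_nhds_zero_of_smul_preimage (by positivity) hn)
  obtain ⟨m, c, hc, hmem⟩ := hA.exists_smul_mem_of_iUnion_closure_completion (h A hA) hz
  obtain ⟨N, hN⟩ := exists_nat_one_div_lt hc
  obtain ⟨k, hk⟩ := (hn.eventually_ge_atTop (max m N)).exists
  refine hzn k ?_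
  have hle : 1 / ((n k : ℝ) + 1) ≤ c :=
    (one_div_le_one_div_of_le (by positivity)
      (by have := (le_max_right m N).trans hk; gcongr)).trans hN.le
  have := hA.real_smul_mem (hA.monotone ((le_max_left m N).trans hk) (hmem k))
    (c := 1 / ((n k : ℝ) + 1) / c) (by
      rw [abs_of_pos (by positivity)]
      exact (div_le_one hc).2 hle)
  rwa [smul_smul, div_mul_cancel₀ _ hc.ne'] at this

end

theorem theorem5p2 {𝕜 : Type*} [RCLike 𝕜] {E : Type*} [AddCommGroup E] [Module 𝕜 E]
    [Module ℝ E] [IsScalarTower ℝ 𝕜 E] [UniformSpace E] [IsUniformAddGroup E]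
    [ContinuousSMul 𝕜 E] [LocallyConvexSpace ℝ E] [T2Space E]
    (hE : IsKappaFrechetUrysohn E) :
    List.TFAE
      [IsBaireLike 𝕜 E,
       BarrelledSpace 𝕜 E,
       ∀ A : ℕ → Set E, IsAbsConvexCover 𝕜 A →
         ⋃ n, closure ((fun x : E => (x : UniformSpace.Completion E)) '' A n) = univ] := by
  have : ContinuousSMul ℝ E := IsScalarTower.continuousSMul 𝕜
  tfae_have 1 → 2 := fun h => h.barrelledSpace
  tfae_have 2 → 1 := fun _ => hE.isBaireLike_of_barrelledSpace
  tfae_have 1 → 3 := fun h _ hA => h.iUnion_closure_completion hA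
  tfae_have 3 → 1 := fun h => hE.isBaireLike_of_iUnion_closure_completion h
  tfae_finish
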